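/- Let $k\ge 1$ and $n\ge 0$ be integers. A generalized Frobenius partition of $n$ with $k$ colors is a two-rowed array $$\begin{pmatrix} a_1 & a_2 & \cdots & a_r\\ b_1 & b_2 & \cdots & b_r\end{pmatrix},\qquad n = r+\sum_{i=1}^r a_i+\sum_{i=1}^r b_i ,$$ with $r\ge 0$, whose entries are nonnegative integers, each carrying one of $k$ colors $1,\dots,k$, such that each row is strictly decreasing with respect to the order $0_1<0_2<\cdots<0_k<1_1<1_2<\cdots<1_k<2_1<\cdots$ (the subscript is the color). The cyclic permutation $1\mapsto 2\mapsto\cdots\mapsto k\mapsto 1$ of the colors acts on these arrays (change the colors of all entries in both rows, then re-sort each row); the order of an array is the least $m\ge 1$ such that applying this permutation $m$ times gives the array back. Let $\overline{c\phi}_k(n)$ (Kolitsch's function) be the number of generalized Frobenius partitions of $n$ with $k$ colors whose order is $k$. Theorem. For all integers $n\ge 0$, $\overline{c\phi}_4(10n+6)\equiv 0\pmod 5$. -/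

import Mathlib

/-- A generalized Frobenius partition of `n` with `k` colors: a two-rowed array with the same
number `r` of entries `a_1, …, a_r` and `b_1, …, b_r` in the two rows, where the entries are
nonnegative integers, each carrying one of `k` colors, each row is strictly decreasing for the
lexicographic order of colored integers (value first, then color), and
`n = r + (a_1 + ⋯ + a_r) + (b_1 + ⋯ + b_r)`.
A strictly decreasing row is the same thing as the finite set of its entries, so each row is a
finite set of pairs (value, color). -/
@[ext]
structure ColoredFrobeniusPartition (k n : ℕ) where
  top : Finset (ℕ × Fin k)
  bottom : Finset (ℕ × Fin k)
  card_eq : top.card = bottom.card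
  size_eq : top.card + ∑ a ∈ top, a.1 + ∑ b ∈ bottom, b.1 = n

namespace ColoredFrobeniusPartition

/-- The permutation of colored integers that keeps the value and sends each color to the
cyclically next one. -/
def shiftColor (k : ℕ) : Equiv.Perm (ℕ × Fin k) :=
  Equiv.prodCongr (Equiv.refl ℕ) (finRotate k)

/-- The cyclic permutation of the `k` colors, applied to every entry of both rows. -/
def rotate {k n : ℕ} (P : ColoredFrobeniusPartition k n) : ColoredFrobeniusPartition k n where
  top := P.top.map (shiftColor k).toEmbedding
  bottom := P.bottom.map (shiftColor k).toEmbedding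
  card_eq := by simpa using P.card_eq
  size_eq := by simpa [shiftColor] using P.size_eq

/-- There are only finitely many such partitions, so that counting them is meaningful. -/
instance instFinite (k n : ℕ) : Finite (ColoredFrobeniusPartition k n) := by
  have hmem : ∀ s : Finset (ℕ × Fin k), ∑ a ∈ s, a.1 ≤ n →
      s ∈ (Finset.range (n + 1) ×ˢ (Finset.univ : Finset (Fin k))).powerset := by
    intro s hs
    rw [Finset.mem_powerset]
    intro a ha
    have h := Finset.single_le_sum (f := fun a : ℕ × Fin k => a.1) (fun _ _ => Nat.zero_le _) ha
    simp only [Finset.mem_product, Finset.mem_range, Finset.mem_univ, and_true]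
    exact Nat.lt_succ_of_le (h.trans hs)
  let S := (Finset.range (n + 1) ×ˢ (Finset.univ : Finset (Fin k))).powerset
  let f : ColoredFrobeniusPartition k n → S × S := fun P =>
    (⟨P.top, hmem _ (by have := P.size_eq; omega)⟩, ⟨P.bottom, hmem _ (by have := P.size_eq; omega)⟩)
  refine Finite.of_injective f ?_
  intro P Q h
  simp only [f, Prod.mk.injEq, Subtype.mk.injEq] at h
  exact ColoredFrobeniusPartition.ext h.1 h.2

end ColoredFrobeniusPartition

/-- Kolitsch's function `c̄φ_k(n)`: the number of generalized Frobenius partitions of `n` with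
`k` colors whose order under cyclic permutation of the `k` colors is exactly `k`, that is, for
which `k` is the least `m ≥ 1` such that rotating the colors `m` times gives the partition back. -/
noncomputable def cphiBar (k n : ℕ) : ℕ :=
  Nat.card {P : ColoredFrobeniusPartition k n //
    Function.minimalPeriod ColoredFrobeniusPartition.rotate P = k}

/-! Sort the entries of an array by color. Each color gives a pair of finite sets with a charge
(difference of cardinalities), and the charges add up to 0. Translation brings a pair of charge `m`
to charge 0 at a cost of `m(m+1)/2` in weight. If `N` (`neutralFun`) counts the pairs of charge 0,
the arrays with `k` colors therefore have generating function `N^k` times the theta series of half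
the sum of squares on integer vectors of sum 0 (`genFun_two`, `genFun_four`). Moreover `N = 1/E`
with `E` Euler's product (`neutralFun_mul_eulerFun`).

With four colors the order divides 4, so it is 4 unless two rotations fix the array. The fixed
arrays of size `2n` are doubled arrays with two colors and size `n`. Hence `cphiBar 4 (2n)` is the
number of all four-colored arrays of `2n` minus the number of two-colored arrays of `n`
(`cphiBar_four_add_card`). Both numbers vanish mod 5 at `10n+6` and `5n+3` respectively.

The mechanism is the same each time. Modulo 5 a fifth power is a series in `q^5`, so a factor `g^5`
does not mix residue classes of exponents. What remains is `E^3` times `φ(q)` or Euler's product at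
`q^4`, or `E(q^2)^4`. Expanding by Jacobi's formula for `E^3`, the relevant class of exponents
forces `x^2 = 2y^2` mod 5 up to squares, where `x` or `y` is Jacobi's coefficient `2m+1`. As 2 is a
nonresidue, `2m+1` vanishes. For two colors, `φ/E^2 = φ E^3/E^5`. For four colors, theta identities
split the series into even and odd parts, and the even part has the needed shape
(`sixteen_mul_genFun_tetrahedralForm`). -/

open PowerSeries

/-! ### Formal generating functions over weighted index sets -/

/-- Every natural number is the weight of finitely many indices only. -/
def FiniteFibers {ι : Type*} (w : ι → ℕ) : Prop := ∀ n, {i | w i = n}.Finite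

namespace FiniteFibers
variable {ι κ : Type*} {w : ι → ℕ} {v : κ → ℕ}

theorem finite_le (hw : FiniteFibers w) (n : ℕ) : {i | w i ≤ n}.Finite := by
  have : {i | w i ≤ n} = ⋃ m ∈ Finset.range (n + 1), {i | w i = m} := by
    ext i; simp
  rw [this]
  exact Set.Finite.biUnion (Finset.finite_toSet _) fun m _ => hw m

theorem of_injective (hw : FiniteFibers w) {f : κ → ι} (hf : f.Injective)
    (h : ∀ k, w (f k) ≤ v k) : FiniteFibers v := fun n =>
  ((hw.finite_le n).preimage hf.injOn).subset fun k (hk : v k = n) => (h k).trans hk.le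

theorem prod (hw : FiniteFibers w) (hv : FiniteFibers v) :
    FiniteFibers fun p : ι × κ => w p.1 + v p.2 := fun n =>
  ((hw.finite_le n).prod (hv.finite_le n)).subset fun p (hp : w p.1 + v p.2 = n) =>
    ⟨show w p.1 ≤ n by omega, show v p.2 ≤ n by omega⟩

theorem sumElim (hw : FiniteFibers w) (hv : FiniteFibers v) :
    FiniteFibers (Sum.elim w v) := fun n =>
  (((hw n).image Sum.inl).union ((hv n).image Sum.inr)).subset <| by
    rintro (i | k) h
    · exact Or.inl ⟨i, h, rfl⟩
    · exact Or.inr ⟨k, h, rfl⟩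

theorem finset (hw : FiniteFibers w) : FiniteFibers fun s : Finset ι => ∑ i ∈ s, w i := fun n => by
  refine ((hw.finite_le n).toFinset.powerset.finite_toSet).subset fun s (hs : _ = n) => ?_
  simp only [Finset.coe_powerset, Set.mem_preimage, Set.mem_powerset_iff, Set.Finite.coe_toFinset]
  intro i hi
  exact (Finset.single_le_sum (f := w) (fun _ _ => Nat.zero_le _) hi).trans hs.le

theorem of_natAbs_le {w : ℤ → ℕ} {a : ℕ} (h : ∀ m, m.natAbs ≤ w m + a) : FiniteFibers w := fun n =>
  (Set.finite_Icc (-(n + a : ℤ)) (n + a)).subset fun m (hm : w m = n) => by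
    have := h m
    rw [Set.mem_Icc]; omega

theorem of_add_le {w : ℕ → ℕ} (h : ∀ m, m ≤ w m) : FiniteFibers w := fun n =>
  (Set.finite_Iic n).subset fun m (hm : w m = n) => (h m).trans hm.le

end FiniteFibers

section genFun
variable {ι κ R : Type*} [CommRing R]

/-- The formal sum of `c i * X ^ w i` over all indices `i`. -/
noncomputable def genFun (w : ι → ℕ) (c : ι → R) : R⟦X⟧ :=
  PowerSeries.mk fun n => ∑ᶠ i ∈ {i | w i = n}, c i

theorem coeff_genFun (w : ι → ℕ) (c : ι → R) (n : ℕ) :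
    coeff n (genFun w c) = ∑ᶠ i ∈ {i | w i = n}, c i := by
  rw [genFun, coeff_mk]

theorem coeff_genFun_eq_sum {w : ι → ℕ} (hw : FiniteFibers w) (c : ι → R) (n : ℕ) :
    coeff n (genFun w c) = ∑ i ∈ (hw n).toFinset, c i := by
  rw [coeff_genFun, finsum_mem_eq_finite_toFinset_sum]

theorem coeff_genFun_eq_zero {w : ι → ℕ} {c : ι → R} {n : ℕ} (h : ∀ i, w i = n → c i = 0) :
    coeff n (genFun w c) = 0 := by
  rw [coeff_genFun]
  exact finsum_mem_eq_zero_of_forall_eq_zero h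

theorem coeff_genFun_one {w : ι → ℕ} (hw : FiniteFibers w) (n : ℕ) :
    coeff n (genFun w fun _ => (1 : R)) = (Nat.card {i // w i = n} : R) := by
  rw [coeff_genFun_eq_sum hw, Finset.sum_const, nsmul_one]
  congr 1
  exact (Nat.card_eq_card_finite_toFinset (hw n)).symm

theorem genFun_equiv (e : κ ≃ ι) (w : ι → ℕ) (c : ι → R) :
    genFun (fun k => w (e k)) (fun k => c (e k)) = genFun w c := by
  ext n
  rw [coeff_genFun, coeff_genFun]
  exact finsum_mem_eq_of_bijOn e ⟨fun k hk => hk, e.injective.injOn, fun i hi =>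
    ⟨e.symm i, by simpa using hi, by simp⟩⟩ fun _ _ => rfl

theorem genFun_congr (e : κ ≃ ι) {w : ι → ℕ} {v : κ → ℕ} {c : ι → R} {d : κ → R}
    (hw : ∀ k, v k = w (e k)) (hc : ∀ k, d k = c (e k)) : genFun v d = genFun w c := by
  rw [← genFun_equiv e w c, funext hw, funext hc]

theorem genFun_mul {w : ι → ℕ} {v : κ → ℕ} (hw : FiniteFibers w) (hv : FiniteFibers v)
    (c : ι → R) (d : κ → R) :
    genFun (fun p : ι × κ => w p.1 + v p.2) (fun p => c p.1 * d p.2) =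
      genFun w c * genFun v d := by
  classical
  ext n
  rw [coeff_mul, coeff_genFun_eq_sum (hw.prod hv)]
  simp_rw [coeff_genFun_eq_sum hw, coeff_genFun_eq_sum hv, Finset.sum_mul_sum,
    ← Finset.sum_product']
  rw [Finset.sum_sigma']
  refine Finset.sum_bij' (fun p _ => ⟨(w p.1, v p.2), p⟩) (fun x _ => x.2) ?_ ?_ ?_ ?_ ?_
  · intro p hp; simpa using hp
  · rintro ⟨⟨a, b⟩, p⟩ hp
    simp at hp ⊢
    omega
  · intro p hp; rfl
  · rintro ⟨⟨a, b⟩, p⟩ hp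
    simp at hp
    obtain ⟨_, rfl, rfl⟩ := hp
    rfl
  · intro p hp; rfl

theorem genFun_sumElim {w : ι → ℕ} {v : κ → ℕ} (hw : FiniteFibers w) (hv : FiniteFibers v)
    (c : ι → R) (d : κ → R) :
    genFun (Sum.elim w v) (Sum.elim c d) = genFun w c + genFun v d := by
  ext n
  rw [map_add, coeff_genFun_eq_sum (hw.sumElim hv), coeff_genFun_eq_sum hw,
    coeff_genFun_eq_sum hv]
  have : ((hw.sumElim hv) n).toFinset = (hw n).toFinset.disjSum (hv n).toFinset := by
    ext (i | k) <;> simp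
  rw [this, Finset.sum_disjSum]
  rfl

theorem genFun_mul_const (a : R) {w : ι → ℕ} (hw : FiniteFibers w) (c : ι → R) :
    genFun w (fun i => a * c i) = C a * genFun w c := by
  ext n
  rw [coeff_C_mul, coeff_genFun_eq_sum hw, coeff_genFun_eq_sum hw, Finset.mul_sum]

theorem genFun_expand {p : ℕ} (hp : p ≠ 0) (w : ι → ℕ) (c : ι → R) :
    genFun (fun i => p * w i) c = expand p hp (genFun w c) := by
  ext n
  rw [coeff_expand, coeff_genFun]
  split_ifs with h
  · obtain ⟨m, rfl⟩ := h
    rw [Nat.mul_div_cancel_left _ (Nat.pos_of_ne_zero hp), coeff_genFun]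
    simp [hp]
  · refine finsum_mem_eq_zero_of_forall_eq_zero fun i hi => (h ?_).elim
    exact ⟨w i, hi.symm⟩

theorem genFun_add_const (a : ℕ) (w : ι → ℕ) (c : ι → R) :
    genFun (fun i => w i + a) c = X ^ a * genFun w c := by
  ext n
  rw [coeff_X_pow_mul', coeff_genFun]
  split_ifs with h
  · rw [coeff_genFun]
    have : {i | w i + a = n} = {i | w i = n - a} := by ext i; simp; omega
    rw [this]
  · refine finsum_mem_eq_zero_of_forall_eq_zero fun i (hi : _ = n) => (h ?_).elim
    omega

theorem genFun_sum_one {w : ι → ℕ} {v : κ → ℕ} (hw : FiniteFibers w) (hv : FiniteFibers v) :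
    genFun (Sum.elim w v) (fun _ => (1 : R)) = genFun w (fun _ => 1) + genFun v (fun _ => 1) := by
  rw [← genFun_sumElim hw hv]
  congr 1
  ext (i | i) <;> rfl

theorem genFun_mul_one {w : ι → ℕ} {v : κ → ℕ} (hw : FiniteFibers w) (hv : FiniteFibers v) :
    genFun (fun p : ι × κ => w p.1 + v p.2) (fun _ => (1 : R)) =
      genFun w (fun _ => 1) * genFun v (fun _ => 1) := by
  rw [← genFun_mul hw hv]
  simp

/-! ### Infinite products as sums over finite subsets -/

section Product

/-- The expansion of the infinite product of the `1 + c i * X ^ w i`. -/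
noncomputable def prodFun (w : ι → ℕ) (c : ι → R) : R⟦X⟧ :=
  genFun (fun s : Finset ι => ∑ i ∈ s, w i) (fun s => ∏ i ∈ s, c i)

theorem prodFun_equiv (e : κ ≃ ι) (w : ι → ℕ) (c : ι → R) :
    prodFun (fun k => w (e k)) (fun k => c (e k)) = prodFun w c :=
  genFun_congr (Equiv.finsetCongr e) (fun s => by simp) (fun s => by simp)

theorem prodFun_sumElim {w : ι → ℕ} {v : κ → ℕ} (hw : FiniteFibers w) (hv : FiniteFibers v)
    (c : ι → R) (d : κ → R) :
    prodFun (Sum.elim w v) (Sum.elim c d) = prodFun w c * prodFun v d := by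
  rw [prodFun, prodFun, prodFun, ← genFun_mul hw.finset hv.finset]
  symm
  refine genFun_congr Finset.sumEquiv.symm.toEquiv (fun s => ?_) (fun s => ?_)
  · simp [Finset.sumEquiv_symm_apply]
  · simp [Finset.sumEquiv_symm_apply]

theorem prodFun_expand {p : ℕ} (hp : p ≠ 0) (w : ι → ℕ) (c : ι → R) :
    prodFun (fun i => p * w i) c = expand p hp (prodFun w c) := by
  rw [prodFun, prodFun, ← genFun_expand hp]
  simp_rw [Finset.mul_sum]

open WithPiTopology in
theorem hasSum_genFun [TopologicalSpace R] {w : ι → ℕ} (hw : FiniteFibers w)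
    (c : ι → R) : HasSum (fun i => C (c i) * X ^ w i) (genFun w c) := by
  rw [hasSum_iff_hasSum_coeff]
  intro n
  rw [coeff_genFun_eq_sum hw]
  have : ∑ i ∈ (hw n).toFinset, c i =
      ∑ i ∈ (hw n).toFinset, coeff n (C (c i) * X ^ w i) := by
    refine Finset.sum_congr rfl fun i hi => ?_
    rw [Set.Finite.mem_toFinset] at hi
    simp [coeff_C_mul, coeff_X_pow, show w i = n from hi]
  rw [this]
  refine hasSum_sum_of_ne_finset_zero fun i hi => ?_
  rw [Set.Finite.mem_toFinset] at hi
  rw [coeff_C_mul, coeff_X_pow, if_neg (fun h => hi h.symm), mul_zero]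

open WithPiTopology in
theorem hasProd_prodFun [TopologicalSpace R] {w : ι → ℕ} (hw : FiniteFibers w)
    (c : ι → R) : HasProd (fun i => 1 + C (c i) * X ^ w i) (prodFun w c) := by
  refine hasProd_one_add_of_hasSum_prod ?_
  have h : (fun s : Finset ι => ∏ i ∈ s, C (c i) * (X : R⟦X⟧) ^ w i) =
      fun s => C (∏ i ∈ s, c i) * X ^ ∑ i ∈ s, w i := by
    ext1 s
    rw [Finset.prod_mul_distrib, map_prod, Finset.prod_pow_eq_pow_sum]
  rw [h]
  exact hasSum_genFun hw.finset fun s => ∏ i ∈ s, c i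

open WithPiTopology in
/-- The product of the factors `(1 + X ^ w i) * (1 - X ^ w i)`. -/
theorem prodFun_one_mul_prodFun_neg_one {w : ι → ℕ} (hw : FiniteFibers w) :
    prodFun w (fun _ => (1 : R)) * prodFun w (fun _ => -1) =
      expand 2 two_ne_zero (prodFun w fun _ => -1) := by
  -- With discrete coefficients, limits of power series are unique, so two expansions of the same
  -- product agree.
  let : TopologicalSpace R := ⊥
  have : DiscreteTopology R := ⟨rfl⟩
  rw [← prodFun_expand two_ne_zero]
  have h1 := (hasProd_prodFun hw fun _ => (1 : R)).mul (hasProd_prodFun hw fun _ => (-1 : R))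
  have h2 := hasProd_prodFun (R := R) (w := fun i => 2 * w i)
    (hw.of_injective Function.injective_id fun i => by simp; omega) fun _ => -1
  refine h1.unique ?_
  have h : (fun i => (1 + C (1 : R) * X ^ w i) * (1 + C (-1 : R) * X ^ w i)) =
      fun i => 1 + C (-1 : R) * X ^ (2 * w i) := by
    ext1 i
    simp only [map_one, map_neg]
    ring
  rwa [h]

end Product
end genFun

/-! ### Charge, translation and the triple product -/

/-- A finite set of natural numbers amounts to the information whether it contains `0`,
together with the predecessors of its other elements. -/
def finsetNatEquiv : Finset ℕ ≃ Bool × Finset ℕ where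
  toFun s := (decide (0 ∈ s), (s.erase 0).image Nat.pred)
  invFun p := cond p.1 (insert 0 (p.2.map ⟨Nat.succ, Nat.succ_injective⟩))
    (p.2.map ⟨Nat.succ, Nat.succ_injective⟩)
  left_inv s := by
    ext n
    by_cases h : 0 ∈ s <;> rcases n with _ | n
    · simp [h]
    · simp only [h, decide_true, cond_true, Finset.mem_insert, Finset.mem_map, Finset.mem_image,
        Finset.mem_erase]
      constructor
      · rintro (h | ⟨a, ⟨b, ⟨hb, hbs⟩, rfl⟩, hn⟩)
        · simp at h
        · obtain ⟨b, rfl⟩ := Nat.exists_eq_succ_of_ne_zero hb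
          simpa [← hn] using hbs
      · exact fun h => Or.inr ⟨n, ⟨n + 1, ⟨by simp, h⟩, rfl⟩, rfl⟩
    · simp [h]
    · simp only [h, decide_false, cond_false, Finset.mem_map, Finset.mem_image, Finset.mem_erase]
      constructor
      · rintro ⟨a, ⟨b, ⟨hb, hbs⟩, rfl⟩, hn⟩
        obtain ⟨b, rfl⟩ := Nat.exists_eq_succ_of_ne_zero hb
        simpa [← hn] using hbs
      · exact fun h => ⟨n, ⟨n + 1, ⟨by simp, h⟩, rfl⟩, rfl⟩
  right_inv := by
    rintro ⟨b, s⟩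
    have h0 : 0 ∉ s.map ⟨Nat.succ, Nat.succ_injective⟩ := by simp
    have h1 : (s.map ⟨Nat.succ, Nat.succ_injective⟩).image Nat.pred = s := by
      ext n; simp
    cases b
    · simp only [cond_false, h0, decide_false, Finset.erase_eq_of_notMem h0, h1]
    · simp only [cond_true, Finset.mem_insert_self, decide_true, Finset.erase_insert h0, h1]

theorem card_finsetNatEquiv_symm (b : Bool) (s : Finset ℕ) :
    (finsetNatEquiv.symm (b, s)).card = s.card + b.toNat := by
  cases b <;> simp [finsetNatEquiv]

theorem sum_finsetNatEquiv_symm (f : ℕ → ℕ) (b : Bool) (s : Finset ℕ) :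
    ∑ n ∈ finsetNatEquiv.symm (b, s), f n = b.toNat * f 0 + ∑ n ∈ s, f (n + 1) := by
  cases b <;> simp [finsetNatEquiv]

namespace FinsetPair

/-- The charge of a pair of finite sets. -/
def charge (x : Finset ℕ × Finset ℕ) : ℤ := x.1.card - x.2.card

/-- The contribution of a pair of finite sets to the size of a Frobenius partition. -/
def weight (x : Finset ℕ × Finset ℕ) : ℕ := ∑ s ∈ x.1, (s + 1) + ∑ t ∈ x.2, t

/-- A pair of finite sets describes a set of integers that contains almost all negative and
almost no nonnegative integers; this is the translation of such sets by `1`. -/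
def shift : Equiv.Perm (Finset ℕ × Finset ℕ) where
  toFun x := (finsetNatEquiv.symm (!(finsetNatEquiv x.2).1, x.1), (finsetNatEquiv x.2).2)
  invFun y := ((finsetNatEquiv y.1).2, finsetNatEquiv.symm (!(finsetNatEquiv y.1).1, y.2))
  left_inv x := by simp
  right_inv x := by simp

theorem charge_shift (x) : charge (shift x) = charge x + 1 := by
  obtain ⟨s, t⟩ := x
  obtain ⟨⟨b, t⟩, rfl⟩ := finsetNatEquiv.symm.surjective t
  cases b <;> simp [charge, shift, card_finsetNatEquiv_symm] <;> ring

/-- Members of the first set rise by 1 and members of the second drop by 1, which gives the charge.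
The extra 1 comes from the boundary: either a new 0 enters the first set with weight 1, or a 0
leaves the second set instead of dropping. -/
theorem weight_shift (x) : (weight (shift x) : ℤ) = weight x + charge x + 1 := by
  obtain ⟨s, t⟩ := x
  obtain ⟨⟨b, t⟩, rfl⟩ := finsetNatEquiv.symm.surjective t
  cases b <;> simp [charge, weight, shift, card_finsetNatEquiv_symm, sum_finsetNatEquiv_symm,
    Finset.sum_add_distrib] <;> ring

theorem charge_shift_zpow (m : ℤ) (x) : charge ((shift ^ m) x) = charge x + m := by
  induction m using Int.induction_on generalizing x with
  | zero => simp
  | succ n ih => rw [zpow_add_one, Equiv.Perm.mul_apply, ih, charge_shift]; ring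
  | pred n ih =>
    have h := charge_shift (shift⁻¹ x)
    rw [← Equiv.Perm.mul_apply, mul_inv_cancel, Equiv.Perm.one_apply] at h
    rw [zpow_sub_one, Equiv.Perm.mul_apply, ih, h]; ring

theorem two_mul_weight_shift_zpow (m : ℤ) (x) :
    2 * (weight ((shift ^ m) x) : ℤ) = 2 * weight x + 2 * m * charge x + m * (m + 1) := by
  induction m using Int.induction_on generalizing x with
  | zero => simp
  | succ n ih =>
    rw [zpow_add_one, Equiv.Perm.mul_apply, ih, charge_shift, weight_shift]; ring
  | pred n ih =>
    have h := charge_shift (shift⁻¹ x)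
    have h' := weight_shift (shift⁻¹ x)
    rw [← Equiv.Perm.mul_apply, mul_inv_cancel, Equiv.Perm.one_apply] at h h'
    rw [zpow_sub_one, Equiv.Perm.mul_apply, ih, h, h']; ring

/-- A pair of finite sets is determined by its charge and its translate of charge `0`. -/
def chargeEquiv : ℤ × {x // charge x = 0} ≃ Finset ℕ × Finset ℕ where
  toFun p := (shift ^ p.1) p.2
  invFun x := (charge x, ⟨(shift ^ (-charge x)) x, by rw [charge_shift_zpow]; ring⟩)
  left_inv := by
    rintro ⟨m, x, hx⟩
    have : charge ((shift ^ m) x) = m := by rw [charge_shift_zpow, hx, zero_add]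
    ext1
    · exact this
    · simp [this]
  right_inv x := by simp

theorem charge_chargeEquiv (p) : charge (chargeEquiv p) = p.1 := by
  obtain ⟨m, x, hx⟩ := p
  exact (charge_shift_zpow m x).trans (by rw [hx, zero_add])

end FinsetPair

/-- The triangular number `m * (m + 1) / 2` for an integer `m`. -/
def triangular (m : ℤ) : ℕ := (m * (m + 1) / 2).toNat

theorem two_mul_triangular (m : ℤ) : 2 * (triangular m : ℤ) = m * (m + 1) := by
  have h : 0 ≤ m * (m + 1) := by
    rcases le_or_gt 0 m with h | h
    · positivity
    · exact mul_nonneg_of_nonpos_of_nonpos h.le (by omega)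
  rw [triangular, Int.toNat_of_nonneg (by omega)]
  exact Int.two_mul_ediv_two_of_even (Int.even_mul_succ_self m)

theorem finiteFibers_triangular : FiniteFibers triangular :=
  .of_natAbs_le (a := 1) fun m => by
    have := two_mul_triangular m
    rcases le_or_gt 0 m with h | h <;> zify
    · rw [abs_of_nonneg h]; nlinarith
    · rw [abs_of_neg h]; nlinarith

theorem finiteFibers_pentagonal : FiniteFibers pentagonal := fun n =>
  Set.Finite.preimage pentagonal_injective.injOn (Set.finite_singleton n)

theorem finiteFibers_natAbs_sq : FiniteFibers fun m : ℤ => m.natAbs ^ 2 :=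
  .of_natAbs_le (a := 0) fun _ => Nat.le_self_pow two_ne_zero _

namespace FinsetPair

theorem weight_chargeEquiv (p) :
    weight (chargeEquiv p) = triangular p.1 + weight p.2 := by
  obtain ⟨m, x, hx⟩ := p
  have := two_mul_weight_shift_zpow m x
  have := two_mul_triangular m
  rw [hx] at *
  change weight ((shift ^ m) x) = triangular m + weight x
  zify
  linarith

theorem finiteFibers_weight : FiniteFibers weight :=
  (FiniteFibers.of_add_le fun m => Nat.le_succ m).finset.prod
    (FiniteFibers.of_add_le fun _ => le_rfl).finset

theorem finiteFibers_weight_val : FiniteFibers fun x : {x // charge x = 0} => weight x :=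
  finiteFibers_weight.of_injective Subtype.val_injective fun _ => le_rfl

variable (R : Type*) [CommRing R]

/-- The generating function of the pairs of charge `0`. -/
noncomputable def neutralFun : R⟦X⟧ :=
  genFun (fun x : {x // charge x = 0} => weight x) fun _ => 1

variable {R}

/-- Jacobi's triple product, with an arbitrary function `c` of the charge in place of the powers of
a second variable. -/
theorem genFun_weight (c : ℤ → R) :
    genFun weight (fun x => c (charge x)) = genFun triangular c * neutralFun R := by
  rw [neutralFun, ← genFun_mul finiteFibers_triangular finiteFibers_weight_val]
  symm
  refine genFun_congr chargeEquiv (fun p => (weight_chargeEquiv p).symm) fun p => ?_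
  rw [charge_chargeEquiv, mul_one]

theorem prod_const_neg_one (x : Finset ℕ × Finset ℕ) :
    (∏ _s ∈ x.1, (-1 : R)) * ∏ _t ∈ x.2, (-1 : R) = (Int.negOnePow (charge x) : ℤ) := by
  rw [Finset.prod_const, Finset.prod_const, ← pow_add, charge, Int.negOnePow_sub,
    ← Int.negOnePow_add, ← Nat.cast_add, Int.negOnePow_def, zpow_natCast]
  simp

end FinsetPair

open FinsetPair

/-! ### Euler's function and its inverse -/

section EulerFunction
variable (R : Type*) [CommRing R]

/-- Euler's function, the product of the `1 - X ^ (n + 1)`. -/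
noncomputable def eulerFun : R⟦X⟧ := prodFun (fun n : ℕ => n + 1) fun _ => -1

theorem finiteFibers_add_one : FiniteFibers fun n : ℕ => n + 1 := .of_add_le fun m => Nat.le_succ m

open WithPiTopology in
theorem eulerFun_eq_pentagonalSeries : eulerFun R = pentagonalSeries R := by
  let : TopologicalSpace R := ⊥
  have : DiscreteTopology R := ⟨rfl⟩
  refine (hasProd_prodFun finiteFibers_add_one _).unique ?_
  simpa [sub_eq_add_neg] using hasProd_one_sub_X_pow R

open WithPiTopology in
/-- Euler's pentagonal number theorem. -/
theorem eulerFun_eq_genFun :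
    eulerFun R = genFun pentagonal fun k => ((Int.negOnePow k : ℤ) : R) := by
  let : TopologicalSpace R := ⊥
  have : DiscreteTopology R := ⟨rfl⟩
  rw [eulerFun_eq_pentagonalSeries]
  refine (hasSum_pentagonalSeries R).unique ?_
  simpa using hasSum_genFun finiteFibers_pentagonal fun k => ((Int.negOnePow k : ℤ) : R)

/-- The triple product at `q^3`, with the charge contributing to the exponent. Its theta side is the
pentagonal series, hence `E(q)`. -/
theorem prodFun_mul_prodFun_three :
    prodFun (fun n : ℕ => 3 * n + 2) (fun _ => (-1 : R)) *
      prodFun (fun n : ℕ => 3 * n + 1) (fun _ => (-1 : R)) =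
    eulerFun R * expand 3 three_ne_zero (neutralFun R) := by
  have h2 : FiniteFibers fun n : ℕ => 3 * n + 2 := .of_add_le fun m => by omega
  have h1 : FiniteFibers fun n : ℕ => 3 * n + 1 := .of_add_le fun m => by omega
  rw [prodFun, prodFun, ← genFun_mul h2.finset h1.finset, eulerFun_eq_genFun, neutralFun,
    ← genFun_expand, ← genFun_mul finiteFibers_pentagonal
      (finiteFibers_weight_val.of_injective Function.injective_id fun x => by simp; omega)]
  symm
  -- The exponent is `3 * weight - charge`. At charge `-k` its theta part is `3k(k-1)/2 + k`, the
  -- pentagonal number of `k`.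
  refine genFun_congr (((Equiv.neg ℤ).prodCongr (Equiv.refl _)).trans chargeEquiv)
    (fun p => ?_) (fun p => ?_)
  · have h : ∀ x : Finset ℕ × Finset ℕ, ((∑ i ∈ x.1, (3 * i + 2) + ∑ i ∈ x.2, (3 * i + 1) : ℕ) : ℤ)
        = 3 * weight x - charge x := by
      intro x
      simp only [weight, charge, Finset.sum_add_distrib]
      simp [← Finset.mul_sum]
      ring
    zify
    have h' := h (chargeEquiv (-p.1, p.2))
    rw [weight_chargeEquiv, charge_chargeEquiv] at h'
    push_cast at h'
    have h1 := two_mul_triangular (-p.1)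
    have h2 := two_mul_natCast_pentagonal p.1
    refine Eq.trans ?_ h'.symm
    linarith
  · rw [prod_const_neg_one]
    simp [charge_chargeEquiv]

theorem eulerFun_eq_mul :
    eulerFun R = prodFun (fun n : ℕ => 3 * n + 2) (fun _ => (-1 : R)) *
      prodFun (fun n : ℕ => 3 * n + 1) (fun _ => (-1 : R)) *
      expand 3 three_ne_zero (eulerFun R) := by
  have h2 : FiniteFibers fun n : ℕ => 3 * n + 2 := .of_add_le fun m => by omega
  have h1 : FiniteFibers fun n : ℕ => 3 * n + 1 := .of_add_le fun m => by omega
  have h0 : FiniteFibers fun n : ℕ => 3 * (n + 1) := .of_add_le fun m => by omega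
  let f : (ℕ ⊕ ℕ) ⊕ ℕ → ℕ :=
    Sum.elim (Sum.elim (fun n => 3 * n + 1) (fun n => 3 * n)) (fun n => 3 * n + 2)
  have hf : f.Bijective := by
    constructor
    · rintro ((a | a) | a) ((b | b) | b) h <;> simp [f] at h ⊢ <;> omega
    · intro n
      obtain h | h | h : n % 3 = 0 ∨ n % 3 = 1 ∨ n % 3 = 2 := by omega
      · exact ⟨.inl (.inr (n / 3)), by simp [f]; omega⟩
      · exact ⟨.inl (.inl (n / 3)), by simp [f]; omega⟩
      · exact ⟨.inr (n / 3), by simp [f]; omega⟩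
  rw [eulerFun, ← prodFun_expand, ← prodFun_sumElim h2 h1, ← prodFun_sumElim (h2.sumElim h1) h0,
    ← prodFun_equiv (Equiv.ofBijective f hf)]
  congr 1
  · ext1 ((a | a) | a) <;> (simp [f]; try ring)
  · ext1 ((a | a) | a) <;> rfl

theorem isUnit_eulerFun : IsUnit (eulerFun R) := by
  rw [isUnit_iff_constantCoeff, ← coeff_zero_eq_constantCoeff_apply, eulerFun_eq_pentagonalSeries]
  have := coeff_pentagonalSeries_pentagonal R 0
  simp [pentagonal_def] at this
  simp [this]

/-- Splitting `E(q)` by residues mod 3 and inserting `prodFun_mul_prodFun_three` gives `E(q) = E(q)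
N(q^3) E(q^3)`. Cancel `E(q)` and replace `q^3` by `q`. -/
theorem neutralFun_mul_eulerFun : neutralFun R * eulerFun R = 1 := by
  have h := eulerFun_eq_mul R
  rw [prodFun_mul_prodFun_three, mul_assoc, ← map_mul] at h
  have h' : expand 3 three_ne_zero (neutralFun R * eulerFun R) = 1 :=
    (isUnit_eulerFun R).mul_left_cancel (by rw [← h, mul_one])
  ext n
  rw [← coeff_expand_mul 3 three_ne_zero, h', coeff_one, coeff_one]
  simp

end EulerFunction

/-! ### Theta function identities -/

section Theta
variable (R : Type*) [CommRing R]

/-- The theta function `∑ X ^ (m ^ 2)` over all integers `m`. -/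
noncomputable def squareTheta : R⟦X⟧ := genFun (fun m : ℤ => m.natAbs ^ 2) fun _ => 1

/-- The theta function `∑ X ^ (m * (m + 1) / 2)` over all integers `m`. -/
noncomputable def triangularTheta : R⟦X⟧ := genFun triangular fun _ => 1

theorem FiniteFibers.const_mul {ι : Type*} {w : ι → ℕ} (hw : FiniteFibers w) {a : ℕ}
    (ha : a ≠ 0) : FiniteFibers fun i => a * w i :=
  hw.of_injective Function.injective_id fun _ => Nat.le_mul_of_pos_left _ (Nat.pos_of_ne_zero ha)

theorem FiniteFibers.add_const {ι : Type*} {w : ι → ℕ} (hw : FiniteFibers w) (a : ℕ) :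
    FiniteFibers fun i => w i + a :=
  hw.of_injective Function.injective_id fun _ => Nat.le_add_right _ _

/-- An element 0 of the second set has weight 0, so its presence and absence can be summed inside
the coefficient. -/
theorem genFun_weight_finsetNatEquiv (d : Finset ℕ → Bool → Finset ℕ → R) :
    genFun weight (fun x => d x.1 (finsetNatEquiv x.2).1 (finsetNatEquiv x.2).2) =
      genFun (fun x : Finset ℕ × Finset ℕ => ∑ s ∈ x.1, (s + 1) + ∑ t ∈ x.2, (t + 1))
        (fun x => d x.1 false x.2 + d x.1 true x.2) := by
  have hw : FiniteFibers fun x : Finset ℕ × Finset ℕ =>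
      ∑ s ∈ x.1, (s + 1) + ∑ t ∈ x.2, (t + 1) :=
    finiteFibers_add_one.finset.prod finiteFibers_add_one.finset
  have h : genFun weight (fun x => d x.1 (finsetNatEquiv x.2).1 (finsetNatEquiv x.2).2) =
      genFun (Sum.elim (fun x : Finset ℕ × Finset ℕ => ∑ s ∈ x.1, (s + 1) + ∑ t ∈ x.2, (t + 1))
        (fun x : Finset ℕ × Finset ℕ => ∑ s ∈ x.1, (s + 1) + ∑ t ∈ x.2, (t + 1)))
      (Sum.elim (fun x => d x.1 false x.2) (fun x => d x.1 true x.2)) := by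
    symm
    refine genFun_congr (((Equiv.boolProdEquivSum _).symm.trans
      ((Equiv.prodAssoc _ _ _).symm.trans ((Equiv.prodComm _ _).prodCongr (Equiv.refl _)))).trans
      ((Equiv.prodAssoc _ _ _).trans ((Equiv.refl _).prodCongr finsetNatEquiv.symm)))
      (fun k => ?_) (fun k => ?_)
    · rcases k with k | k <;> simp [weight, sum_finsetNatEquiv_symm]
    · rcases k with k | k <;> simp
  rw [h, genFun_sumElim hw hw]
  ext n
  rw [map_add, coeff_genFun_eq_sum hw, coeff_genFun_eq_sum hw, coeff_genFun_eq_sum hw,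
    Finset.sum_add_distrib]

theorem triangularTheta_mul_neutralFun :
    triangularTheta R * neutralFun R = 2 * prodFun (fun n : ℕ => n + 1) (fun _ => (1 : R)) ^ 2 := by
  rw [triangularTheta, ← genFun_weight (R := R) fun _ => 1,
    genFun_weight_finsetNatEquiv R fun _ _ _ => 1, prodFun, sq,
    ← genFun_mul finiteFibers_add_one.finset finiteFibers_add_one.finset]
  have := genFun_mul_const (2 : R) (finiteFibers_add_one.finset.prod finiteFibers_add_one.finset)
    fun _ => 1
  rw [map_ofNat] at this
  simpa only [Finset.prod_const_one, mul_one, one_add_one_eq_two] using this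

theorem triangularTheta_mul_eulerFun :
    triangularTheta R * eulerFun R = 2 * expand 2 two_ne_zero (eulerFun R) ^ 2 := by
  have h : prodFun (fun n : ℕ => n + 1) (fun _ => (1 : R)) * eulerFun R =
      expand 2 two_ne_zero (eulerFun R) := prodFun_one_mul_prodFun_neg_one finiteFibers_add_one
  rw [← h]
  linear_combination (eulerFun R) ^ 2 * triangularTheta_mul_neutralFun R -
    triangularTheta R * eulerFun R * neutralFun_mul_eulerFun R

theorem charge_eq_finsetNatEquiv (x : Finset ℕ × Finset ℕ) :
    charge x = x.1.card - (finsetNatEquiv x.2).2.card - (finsetNatEquiv x.2).1.toNat := by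
  have := card_finsetNatEquiv_symm (finsetNatEquiv x.2).1 (finsetNatEquiv x.2).2
  rw [Prod.mk.eta, Equiv.symm_apply_apply] at this
  rw [charge, this]
  push_cast
  ring

/-- Jacobi's formula for the cube of Euler's function. -/
theorem two_mul_eulerFun_pow_three :
    2 * eulerFun R ^ 3 =
      genFun triangular fun m => ((Int.negOnePow m : ℤ) * (2 * m + 1) : R) := by
  have h := genFun_weight (R := R) fun m => ((Int.negOnePow m : ℤ) * (2 * m + 1) : R)
  simp_rw [charge_eq_finsetNatEquiv] at h
  rw [genFun_weight_finsetNatEquiv R fun s b t =>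
    ((Int.negOnePow (s.card - t.card - b.toNat) : ℤ) *
      (2 * ((s.card - t.card - b.toNat : ℤ) : R) + 1) : R)] at h
  have h' : 2 * eulerFun R ^ 2 = genFun triangular
      (fun m => ((Int.negOnePow m : ℤ) * (2 * m + 1) : R)) * neutralFun R := by
    rw [← h, eulerFun, prodFun, sq, ← genFun_mul finiteFibers_add_one.finset
      finiteFibers_add_one.finset, ← map_ofNat (C (R := R)), ← genFun_mul_const _
      (finiteFibers_add_one.finset.prod finiteFibers_add_one.finset)]
    congr 1
    ext1 x
    rw [prod_const_neg_one, charge]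
    -- With `m` the charge when 0 is absent, the two terms are `(-1)^m (2m+1)` and `-(-1)^m (2m-1)`.
    -- They add up to `2(-1)^m`, the coefficient of `2E^2`.
    simp only [Bool.toNat_false, Bool.toNat_true, Nat.cast_zero, Nat.cast_one, sub_zero,
      Int.negOnePow_sub _ 1]
    simp
    ring
  linear_combination eulerFun R * h' + (genFun triangular
      (fun m => ((Int.negOnePow m : ℤ) * (2 * m + 1) : R))) * neutralFun_mul_eulerFun R

/-- Pairs `(a, b)` are separated by the parity of `a + b` and rewritten through half-sums and
half-differences. -/
theorem squareTheta_sq :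
    squareTheta R ^ 2 = expand 2 two_ne_zero (squareTheta R) ^ 2 +
      X * expand 4 four_ne_zero (triangularTheta R) ^ 2 := by
  let f : ℤ × ℤ ⊕ ℤ × ℤ → ℤ × ℤ :=
    Sum.elim (fun p => (p.1 + p.2, p.1 - p.2)) (fun p => (p.1 + p.2 + 1, p.1 - p.2))
  have hf : f.Bijective := by
    constructor
    · rintro (⟨a, b⟩ | ⟨a, b⟩) (⟨c, d⟩ | ⟨c, d⟩) h <;> simp [f] at h ⊢ <;> omega
    · rintro ⟨a, b⟩
      obtain h | h : (a + b) % 2 = 0 ∨ (a + b) % 2 = 1 := by omega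
      · exact ⟨.inl ((a + b) / 2, (a - b) / 2), by simp [f]; omega⟩
      · exact ⟨.inr ((a + b - 1) / 2, (a - b - 1) / 2), by simp [f]; omega⟩
  have hs := finiteFibers_natAbs_sq.const_mul two_ne_zero
  have ht := finiteFibers_triangular.const_mul four_ne_zero
  rw [sq, sq, sq, squareTheta, triangularTheta, ← genFun_expand, ← genFun_expand,
    ← genFun_mul_one finiteFibers_natAbs_sq finiteFibers_natAbs_sq, ← genFun_mul_one hs hs,
    ← genFun_mul_one ht ht, ← pow_one X, ← genFun_add_const,
    ← genFun_sum_one (hs.prod hs) ((ht.prod ht).add_const 1)]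
  symm
  refine genFun_congr (Equiv.ofBijective f hf) (fun k => ?_) (fun k => rfl)
  rcases k with ⟨a, b⟩ | ⟨a, b⟩ <;> simp only [f, Equiv.ofBijective_apply, Sum.elim_inl,
    Sum.elim_inr] <;> zify <;> simp only [sq_abs]
  · ring
  · linear_combination 2 * two_mul_triangular a + 2 * two_mul_triangular b

/-- For `a`, `b` of equal parity, half-sum and half-difference diagonalize the form. The reflection
`b ↦ -1 - b` preserves triangular numbers and changes parity, so the other pairs give an equal copy.
-/
theorem triangularTheta_sq :
    triangularTheta R ^ 2 =
      2 * (squareTheta R * expand 2 two_ne_zero (triangularTheta R)) := by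
  let f : ℤ × ℤ ⊕ ℤ × ℤ → ℤ × ℤ :=
    Sum.elim (fun p => (p.2 + p.1, p.2 - p.1)) (fun p => (p.2 + p.1, -1 - p.2 + p.1))
  have hf : f.Bijective := by
    constructor
    · rintro (⟨a, b⟩ | ⟨a, b⟩) (⟨c, d⟩ | ⟨c, d⟩) h <;> simp [f] at h ⊢ <;> omega
    · rintro ⟨a, b⟩
      obtain h | h : (a + b) % 2 = 0 ∨ (a + b) % 2 = 1 := by omega
      · exact ⟨.inl ((a - b) / 2, (a + b) / 2), by simp [f]; omega⟩
      · exact ⟨.inr ((a + b + 1) / 2, (a - b - 1) / 2), by simp [f]; omega⟩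
  have hs := finiteFibers_natAbs_sq
  have ht := finiteFibers_triangular.const_mul two_ne_zero
  rw [sq, two_mul, squareTheta, triangularTheta, ← genFun_expand,
    ← genFun_mul_one finiteFibers_triangular finiteFibers_triangular,
    ← genFun_mul_one hs ht, ← genFun_sum_one (hs.prod ht) (hs.prod ht)]
  symm
  refine genFun_congr (Equiv.ofBijective f hf) (fun k => ?_) (fun k => rfl)
  rcases k with ⟨a, b⟩ | ⟨a, b⟩ <;> simp only [f, Equiv.ofBijective_apply, Sum.elim_inl,
    Sum.elim_inr] <;> zify <;> simp only [sq_abs] <;> rw [← mul_right_inj' (two_ne_zero' ℤ)]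
  · linear_combination 2 * two_mul_triangular b - two_mul_triangular (b + a) -
      two_mul_triangular (b - a)
  · linear_combination 2 * two_mul_triangular b - two_mul_triangular (b + a) -
      two_mul_triangular (-1 - b + a)

/-- Half the sum of the squares of four integers of sum `0`, in terms of three of them. -/
def tetrahedralForm (m : ℤ × ℤ × ℤ) : ℕ :=
  (m.1 ^ 2 + m.2.1 ^ 2 + m.2.2 ^ 2 + m.1 * m.2.1 + m.1 * m.2.2 + m.2.1 * m.2.2).toNat

theorem two_mul_tetrahedralForm (m : ℤ × ℤ × ℤ) : 2 * (tetrahedralForm m : ℤ) =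
    (m.1 + m.2.1) ^ 2 + (m.1 + m.2.2) ^ 2 + (m.2.1 + m.2.2) ^ 2 := by
  rw [tetrahedralForm, Int.toNat_of_nonneg]
  · ring
  · nlinarith [sq_nonneg (m.1 + m.2.1), sq_nonneg (m.1 + m.2.2), sq_nonneg (m.2.1 + m.2.2)]

theorem finiteFibers_tetrahedralForm : FiniteFibers tetrahedralForm := by
  have h : FiniteFibers fun m => 2 * tetrahedralForm m :=
    (finiteFibers_natAbs_sq.prod (finiteFibers_natAbs_sq.prod
      finiteFibers_natAbs_sq)).of_injective Function.injective_id fun m => by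
    have := two_mul_tetrahedralForm m
    simp only [id]
    zify
    simp only [sq_abs]
    nlinarith [sq_nonneg (m.1 + m.2.1 + m.2.2)]
  exact fun n => (h (2 * n)).subset fun m (hm : tetrahedralForm m = n) =>
    congrArg (2 * ·) hm

/-- Twice the form is the sum of squares of the three pairwise sums, whose total is even. Either all
three are even, giving the cube, or exactly one is, giving three equal copies of the mixed term. -/
theorem genFun_tetrahedralForm :
    genFun tetrahedralForm (fun _ => (1 : R)) = expand 2 two_ne_zero (squareTheta R) ^ 3 +
      3 * X * expand 2 two_ne_zero (squareTheta R) *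
        expand 4 four_ne_zero (triangularTheta R) ^ 2 := by
  let f : ((ℤ × ℤ × ℤ) ⊕ (ℤ × ℤ × ℤ)) ⊕ ((ℤ × ℤ × ℤ) ⊕ (ℤ × ℤ × ℤ)) → ℤ × ℤ × ℤ :=
    Sum.elim (Sum.elim (fun p => (p.1 + p.2.1 - p.2.2, p.1 + p.2.2 - p.2.1, p.2.1 + p.2.2 - p.1))
      (fun p => (p.2.1 + p.2.2 + 1 - p.1, p.2.1 + p.1 - p.2.2, p.2.2 + p.1 - p.2.1)))
      (Sum.elim (fun p => (p.2.1 + p.1 - p.2.2, p.2.1 + p.2.2 + 1 - p.1, p.2.2 + p.1 - p.2.1))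
      (fun p => (p.2.1 + p.1 - p.2.2, p.2.2 + p.1 - p.2.1, p.2.1 + p.2.2 + 1 - p.1)))
  have hf : f.Bijective := by
    constructor
    · rintro ((⟨a, b, c⟩ | ⟨a, b, c⟩) | (⟨a, b, c⟩ | ⟨a, b, c⟩))
        ((⟨d, e, g⟩ | ⟨d, e, g⟩) | (⟨d, e, g⟩ | ⟨d, e, g⟩)) h <;>
        simp [f] at h ⊢ <;> omega
    · rintro ⟨a, b, c⟩
      obtain h | h : (a + b) % 2 = 0 ∨ (a + b) % 2 = 1 := by omega
      · obtain h' | h' : (a + c) % 2 = 0 ∨ (a + c) % 2 = 1 := by omega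
        · exact ⟨.inl (.inl ((a + b) / 2, (a + c) / 2, (b + c) / 2)), by simp [f]; omega⟩
        · exact ⟨.inr (.inr ((a + b) / 2, (a + c - 1) / 2, (b + c - 1) / 2)), by simp [f]; omega⟩
      · obtain h' | h' : (a + c) % 2 = 0 ∨ (a + c) % 2 = 1 := by omega
        · exact ⟨.inr (.inl ((a + c) / 2, (a + b - 1) / 2, (b + c - 1) / 2)), by simp [f]; omega⟩
        · exact ⟨.inl (.inr ((b + c) / 2, (a + b - 1) / 2, (a + c - 1) / 2)), by simp [f]; omega⟩
  have hs := finiteFibers_natAbs_sq.const_mul two_ne_zero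
  have ht := finiteFibers_triangular.const_mul four_ne_zero
  have hsss := hs.prod (hs.prod hs)
  have hstt := (hs.prod (ht.prod ht)).add_const 1
  have h3 : expand 2 two_ne_zero (squareTheta R) ^ 3 +
      3 * X * expand 2 two_ne_zero (squareTheta R) *
        expand 4 four_ne_zero (triangularTheta R) ^ 2 =
      (expand 2 two_ne_zero (squareTheta R) * (expand 2 two_ne_zero (squareTheta R) *
        expand 2 two_ne_zero (squareTheta R)) +
      X ^ 1 * (expand 2 two_ne_zero (squareTheta R) *
        (expand 4 four_ne_zero (triangularTheta R) *
          expand 4 four_ne_zero (triangularTheta R)))) +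
      (X ^ 1 * (expand 2 two_ne_zero (squareTheta R) *
        (expand 4 four_ne_zero (triangularTheta R) *
          expand 4 four_ne_zero (triangularTheta R))) +
      X ^ 1 * (expand 2 two_ne_zero (squareTheta R) *
        (expand 4 four_ne_zero (triangularTheta R) *
          expand 4 four_ne_zero (triangularTheta R)))) := by ring
  rw [h3, squareTheta, triangularTheta, ← genFun_expand, ← genFun_expand,
    ← genFun_mul_one hs hs, ← genFun_mul_one hs (hs.prod hs),
    ← genFun_mul_one ht ht, ← genFun_mul_one hs (ht.prod ht), ← genFun_add_const,
    ← genFun_sum_one hstt hstt, ← genFun_sum_one hsss hstt,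
    ← genFun_sum_one (hsss.sumElim hstt) (hstt.sumElim hstt)]
  symm
  refine genFun_congr (Equiv.ofBijective f hf) (fun k => ?_) (fun k => rfl)
  rcases k with (⟨a, b, c⟩ | ⟨a, b, c⟩) | (⟨a, b, c⟩ | ⟨a, b, c⟩) <;>
    simp only [f, Equiv.ofBijective_apply, Sum.elim_inl, Sum.elim_inr] <;> zify <;>
    simp only [sq_abs] <;> rw [← mul_right_inj' (two_ne_zero' ℤ), two_mul_tetrahedralForm]
  · ring
  all_goals linear_combination 4 * two_mul_triangular b + 4 * two_mul_triangular c

end Theta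

/-! ### Even and odd parts of the four-color series -/

section Dissection
variable (R : Type*) [CommRing R]

theorem triangularTheta_eq :
    triangularTheta R = 2 * expand 2 two_ne_zero (eulerFun R) ^ 2 * neutralFun R := by
  linear_combination neutralFun R * triangularTheta_mul_eulerFun R -
    triangularTheta R * neutralFun_mul_eulerFun R

/-- The factor 16 serves to write `(2W)^4 = T^4 V^8 = 4 F^2 T2^2 V^8`, where only `F^2` has odd
powers, and `squareTheta_sq` dissects it. The even part is then arranged as fifth powers times
products containing a cube of Euler's function. -/
theorem sixteen_mul_genFun_tetrahedralForm : ∃ f g h : R⟦X⟧,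
    16 * (genFun tetrahedralForm (fun _ => 1) * neutralFun R ^ 4) =
      expand 2 two_ne_zero
        (16 * (expand 2 two_ne_zero (eulerFun R * eulerFun R ^ 3) * f ^ 5) +
          768 * (X * (expand 4 four_ne_zero (eulerFun R) * eulerFun R ^ 3 * g ^ 5))) +
      X * expand 2 two_ne_zero h := by
  have e4 (f : R⟦X⟧) : expand 2 two_ne_zero (expand 2 two_ne_zero f) = expand 4 four_ne_zero f :=
    (expand_mul 2 two_ne_zero 2 two_ne_zero f).symm
  set E := eulerFun R with hE
  set W := neutralFun R with hW
  set F := squareTheta R with hF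
  set T := triangularTheta R with hT
  set E2 := expand 2 two_ne_zero E with hE2
  set V := expand 2 two_ne_zero W with hV
  set T2 := expand 2 two_ne_zero T with hT2
  set E4 := expand 4 four_ne_zero E with hE4
  have hWE : W * E = 1 := neutralFun_mul_eulerFun R
  have hVE : V * E2 = 1 := by rw [hV, hE2, ← map_mul, hWE, map_one]
  have hTW : T = 2 * E2 ^ 2 * W := triangularTheta_eq R
  have hT2V : T2 = 2 * E4 ^ 2 * V := by
    rw [hT2, hTW, map_mul, map_mul, map_pow, hE2, e4, map_ofNat]
  have hsq : F ^ 2 = expand 2 two_ne_zero F ^ 2 + X * expand 4 four_ne_zero T ^ 2 :=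
    squareTheta_sq R
  have htr : T ^ 2 = 2 * (F * T2) := triangularTheta_sq R
  have h2W : 2 * W = T * V ^ 2 := by
    rw [hTW]
    linear_combination -(2 * W) * (V * E2 + 1) * hVE
  have hfirst : 4 * W ^ 8 * T ^ 2 * F ^ 5 =
      16 * (expand 2 two_ne_zero (E * E ^ 3) * (W ^ 2 * F) ^ 5) := by
    rw [map_mul, map_pow, ← hE2, hTW]
    ring
  have hsecond : 12 * X * W ^ 8 * T ^ 2 * F * T2 ^ 4 =
      768 * (X * (E4 * E ^ 3 * (W ^ 3 * E2 * E4) ^ 5)) := by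
    have h1 : 12 * X * W ^ 8 * T ^ 2 * F * T2 ^ 4 = 6 * X * W ^ 8 * T ^ 4 * T2 ^ 3 := by
      linear_combination -(6 * X * W ^ 8 * T ^ 2 * T2 ^ 3) * htr
    have h2 : E2 ^ 8 * V ^ 3 = E2 ^ 5 := by
      calc E2 ^ 8 * V ^ 3 = E2 ^ 5 * (V * E2) ^ 3 := by ring
        _ = E2 ^ 5 := by rw [hVE, one_pow, mul_one]
    have h3 : W ^ 15 * E ^ 3 = W ^ 12 := by
      calc W ^ 15 * E ^ 3 = W ^ 12 * (W * E) ^ 3 := by ring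
        _ = W ^ 12 := by rw [hWE, one_pow, mul_one]
    rw [h1, hTW, hT2V]
    linear_combination (768 * X * W ^ 12 * E4 ^ 6) * h2 - (768 * X * E4 ^ 6 * E2 ^ 5) * h3
  -- In the odd part the two cross terms have coefficients 1 and 3; with the factor 4 this gives 16.
  refine ⟨W ^ 2 * F, W ^ 3 * E2 * E4, 16 * W ^ 8 * T ^ 2 * F ^ 3 * T2 ^ 2, ?_⟩
  rw [← hfirst, ← hsecond, genFun_tetrahedralForm, ← hF, ← hT]
  simp only [map_mul, map_add, map_pow, map_ofNat, ← hV, ← hT2, expand_X]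
  rw [hT2, e4, ← hT2]
  have hW4 : 16 * W ^ 4 = 4 * (expand 2 two_ne_zero F ^ 2 + X * expand 4 four_ne_zero T ^ 2) *
      T2 ^ 2 * V ^ 8 := by
    rw [← hsq]
    calc 16 * W ^ 4 = (2 * W) ^ 4 := by ring
      _ = (T ^ 2) ^ 2 * V ^ 8 := by rw [h2W]; ring
      _ = _ := by rw [htr]; ring
  linear_combination (expand 2 two_ne_zero F ^ 3 + 3 * X * expand 2 two_ne_zero F *
    expand 4 four_ne_zero T ^ 2) * hW4

end Dissection

/-! ### Vanishing of coefficients modulo 5 -/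

section ModFive

theorem pow_five_eq_expand (f : (ZMod 5)⟦X⟧) : f ^ 5 = expand 5 (by norm_num) f := by
  have : Fact (Nat.Prime 5) := ⟨by norm_num⟩
  rw [← MvPowerSeries.map_frobenius_expand 5 (by norm_num)]
  rw [ZMod.frobenius_zmod, MvPowerSeries.map_id]
  rfl

/-- By Frobenius `g^5` only has exponents divisible by 5, so each residue class of exponents of `f`
is kept apart. -/
theorem coeff_mul_pow_five {f : (ZMod 5)⟦X⟧} {r : ℕ} (hr : r < 5)
    (h : ∀ n, coeff (5 * n + r) f = 0) (g : (ZMod 5)⟦X⟧) (n : ℕ) :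
    coeff (5 * n + r) (f * g ^ 5) = 0 := by
  rw [pow_five_eq_expand, coeff_mul]
  refine Finset.sum_eq_zero fun p hp => ?_
  rw [Finset.HasAntidiagonal.mem_antidiagonal] at hp
  rw [coeff_expand]
  split_ifs with hd
  · obtain ⟨j, hj⟩ := hd
    rw [show p.1 = 5 * (n - j) + r by omega, h, zero_mul]
  · rw [mul_zero]

theorem eulerFun_pow_three_eq :
    eulerFun (ZMod 5) ^ 3 =
      3 * genFun triangular fun m => ((Int.negOnePow m : ℤ) * (2 * m + 1) : ZMod 5) := by
  have h5 : (5 : (ZMod 5)⟦X⟧) = 0 := by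
    rw [← map_ofNat (C (R := ZMod 5)), show (OfNat.ofNat 5 : ZMod 5) = 0 from rfl, map_zero]
  rw [← two_mul_eulerFun_pow_three]
  linear_combination -(eulerFun (ZMod 5) ^ 3) * h5

/-- Every contribution to the coefficient carries Jacobi's factor `2m+1`, so it suffices that the
exponent equation forces this to vanish. -/
theorem coeff_genFun_mul_eulerFun_pow_three {ι : Type*} {w : ι → ℕ} (hw : FiniteFibers w)
    (c : ι → ZMod 5) {a : ℕ} (ha : a ≠ 0) {n : ℕ}
    (h : ∀ i m, w i + a * triangular m = n → (2 * m + 1 : ZMod 5) = 0) :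
    coeff n (genFun w c * expand a ha (eulerFun (ZMod 5) ^ 3)) = 0 := by
  rw [eulerFun_pow_three_eq, map_mul (expand a ha), map_ofNat, mul_left_comm, ← map_ofNat (C (R := ZMod 5)),
    coeff_C_mul, ← genFun_expand, ← genFun_mul hw (finiteFibers_triangular.const_mul ha),
    coeff_genFun_eq_zero, mul_zero]
  intro p hp
  rw [h p.1 p.2 hp, mul_zero, mul_zero]

theorem two_mul_triangular_zmod (m : ℤ) :
    2 * (triangular m : ZMod 5) = (m : ZMod 5) * (m + 1) := by
  exact_mod_cast congrArg (Int.cast : ℤ → ZMod 5) (two_mul_triangular m)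

theorem two_mul_pentagonal_zmod (m : ℤ) :
    2 * (pentagonal m : ZMod 5) = (m : ZMod 5) * (3 * m - 1) := by
  exact_mod_cast congrArg (Int.cast : ℤ → ZMod 5) (two_mul_natCast_pentagonal m)

theorem coeff_squareTheta_mul (n : ℕ) :
    coeff (5 * n + 3) (squareTheta (ZMod 5) * eulerFun (ZMod 5) ^ 3) = 0 := by
  -- Completing the square, `8a^2 + (2b+1)^2 = 8·3 + 1 = 0`, that is `(2b+1)^2 = 2a^2`, and 2 is not
  -- a square mod 5.
  have key : ∀ a b t : ZMod 5, 2 * t = b * (b + 1) → a ^ 2 + t = 3 → 2 * b + 1 = 0 := by decide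
  have h := coeff_genFun_mul_eulerFun_pow_three (n := 5 * n + 3) finiteFibers_natAbs_sq
    (fun _ => 1) one_ne_zero fun i m hm =>
    key i m _ (two_mul_triangular_zmod m) ?_
  · rwa [expand_one_apply] at h
  · have h' := congrArg (Int.cast : ℤ → ZMod 5) (congrArg (Nat.cast : ℕ → ℤ) hm)
    push_cast [sq_abs] at h'
    rw [show (5 : ZMod 5) = 0 from rfl] at h'
    simpa using h'

theorem coeff_expand_two_eulerFun_mul (n : ℕ) :
    coeff (5 * n + 3) (expand 2 two_ne_zero (eulerFun (ZMod 5) * eulerFun (ZMod 5) ^ 3)) = 0 := by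
  -- Here `s + t = 4`, so `(6a-1)^2 + 3(2b+1)^2 = 24·4 + 4 = 0`, and `-3 = 2` is not a square.
  have key : ∀ a b s t : ZMod 5, 2 * s = a * (3 * a - 1) → 2 * t = b * (b + 1) →
      2 * s + 2 * t = 3 → 2 * b + 1 = 0 := by decide
  rw [map_mul, eulerFun_eq_genFun, ← genFun_expand, ← eulerFun_eq_genFun]
  refine coeff_genFun_mul_eulerFun_pow_three (finiteFibers_pentagonal.const_mul two_ne_zero) _ _
    fun i m hm => key i m _ _ (two_mul_pentagonal_zmod i) (two_mul_triangular_zmod m) ?_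
  have h' := congrArg (Nat.cast : ℕ → ZMod 5) hm
  push_cast at h'
  rw [show (5 : ZMod 5) = 0 from rfl] at h'
  simpa using h'

theorem coeff_expand_four_eulerFun_mul (n : ℕ) :
    coeff (5 * n + 2)
      (expand 4 four_ne_zero (eulerFun (ZMod 5)) * eulerFun (ZMod 5) ^ 3) = 0 := by
  -- Here `4(6a-1)^2 + 3(2b+1)^2 = 24·2 + 7 = 0`, with the same nonresidue `-3`.
  have key : ∀ a b s t : ZMod 5, 2 * s = a * (3 * a - 1) → 2 * t = b * (b + 1) →
      4 * s + t = 2 → 2 * b + 1 = 0 := by decide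
  have h := coeff_genFun_mul_eulerFun_pow_three (n := 5 * n + 2)
    (finiteFibers_pentagonal.const_mul four_ne_zero)
    (fun k => ((Int.negOnePow k : ℤ) : ZMod 5)) one_ne_zero
    fun i m hm => key i m _ _ (two_mul_pentagonal_zmod i) (two_mul_triangular_zmod m) ?_
  · rwa [expand_one_apply, genFun_expand four_ne_zero, ← eulerFun_eq_genFun] at h
  · have h' := congrArg (Nat.cast : ℕ → ZMod 5) hm
    push_cast at h'
    rw [show (5 : ZMod 5) = 0 from rfl] at h'
    simpa using h'

theorem coeff_squareTheta_mul_neutralFun (n : ℕ) :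
    coeff (5 * n + 3) (squareTheta (ZMod 5) * neutralFun (ZMod 5) ^ 2) = 0 := by
  have h := coeff_mul_pow_five (by norm_num) coeff_squareTheta_mul (neutralFun (ZMod 5)) n
  have hWE : (neutralFun (ZMod 5) * eulerFun (ZMod 5)) ^ 3 = 1 := by
    rw [neutralFun_mul_eulerFun, one_pow]
  rwa [show squareTheta (ZMod 5) * eulerFun (ZMod 5) ^ 3 * neutralFun (ZMod 5) ^ 5 =
    squareTheta (ZMod 5) * neutralFun (ZMod 5) ^ 2 by
      linear_combination squareTheta (ZMod 5) * neutralFun (ZMod 5) ^ 2 * hWE] at h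

theorem coeff_genFun_tetrahedralForm_mul_neutralFun (n : ℕ) :
    coeff (10 * n + 6) (genFun tetrahedralForm (fun _ => (1 : ZMod 5)) *
      neutralFun (ZMod 5) ^ 4) = 0 := by
  obtain ⟨f, g, h, hfgh⟩ := sixteen_mul_genFun_tetrahedralForm (ZMod 5)
  have H := congrArg (coeff (2 * (5 * n + 3))) hfgh
  -- The index is even, so the odd part drops out. In the even part the index is `5n+3`, and the
  -- factor `X` of the second term lowers it to `5n+2`.
  rw [map_add, coeff_expand_mul, map_add, show 2 * (5 * n + 3) = 2 * (5 * n + 2) + 1 + 1 by ring,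
    coeff_succ_X_mul, coeff_expand_of_not_dvd 2 _ _ (by omega), add_zero] at H
  simp only [← map_ofNat (C (R := ZMod 5)), coeff_C_mul] at H
  rw [coeff_mul_pow_five (by norm_num) coeff_expand_two_eulerFun_mul,
    show 5 * n + 3 = 5 * n + 2 + 1 by ring, coeff_succ_X_mul,
    coeff_mul_pow_five (by norm_num) coeff_expand_four_eulerFun_mul] at H
  rw [show 10 * n + 6 = 2 * (5 * n + 2) + 1 + 1 by ring]
  rw [show (OfNat.ofNat 16 : ZMod 5) = 1 from rfl] at H
  simpa using H

end ModFive

/-! ### Colored arrays as families of pairs, and their rotations -/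

/-- A finite set of colored integers is a family of finite sets of integers. -/
def colorEquiv (k : ℕ) : (Fin k → Finset ℕ) ≃ Finset (ℕ × Fin k) where
  toFun g := (Finset.univ.sigma g).map
    ((Equiv.sigmaEquivProd (Fin k) ℕ).trans (Equiv.prodComm _ _)).toEmbedding
  invFun s c := (s.filter fun a => a.2 = c).image Prod.fst
  left_inv g := by ext c n; simp
  right_inv s := by ext ⟨n, c⟩; simp

theorem mem_colorEquiv {k : ℕ} {g : Fin k → Finset ℕ} {a : ℕ × Fin k} :
    a ∈ colorEquiv k g ↔ a.1 ∈ g a.2 := by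
  obtain ⟨n, c⟩ := a
  simp [colorEquiv]

theorem card_colorEquiv {k : ℕ} (g : Fin k → Finset ℕ) :
    (colorEquiv k g).card = ∑ c, (g c).card := by
  simp [colorEquiv]

theorem sum_colorEquiv {k : ℕ} (g : Fin k → Finset ℕ) :
    ∑ a ∈ colorEquiv k g, a.1 = ∑ c, ∑ n ∈ g c, n := by
  simp [colorEquiv, Finset.sum_sigma]

theorem colorEquiv_map_shiftColor {k : ℕ} (g : Fin k → Finset ℕ) :
    (colorEquiv k g).map (ColoredFrobeniusPartition.shiftColor k).toEmbedding =
      colorEquiv k (g ∘ (finRotate k).symm) := by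
  ext ⟨n, c⟩
  rw [Finset.mem_map_equiv, mem_colorEquiv, mem_colorEquiv]
  rfl

/-- Families of pairs of finite sets, indexed by `k` colors, of total charge `0`. -/
abbrev NeutralFamily (k : ℕ) : Type :=
  {x : Fin k → Finset ℕ × Finset ℕ // ∑ c, charge (x c) = 0}

namespace NeutralFamily

/-- The total weight of a family of pairs of finite sets. -/
def weight {k : ℕ} (x : NeutralFamily k) : ℕ := ∑ c, FinsetPair.weight (x.1 c)

end NeutralFamily

namespace ColoredFrobeniusPartition

/-- Split a generalized Frobenius partition according to the colors of its entries. -/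
def familyEquiv (k n : ℕ) :
    ColoredFrobeniusPartition k n ≃ {x : NeutralFamily k // x.weight = n} where
  toFun P := ⟨⟨fun c => ((colorEquiv k).symm P.top c, (colorEquiv k).symm P.bottom c), by
      have h := P.card_eq
      rw [← (colorEquiv k).apply_symm_apply P.top, ← (colorEquiv k).apply_symm_apply P.bottom,
        card_colorEquiv, card_colorEquiv] at h
      simp only [charge, Finset.sum_sub_distrib]
      exact_mod_cast sub_eq_zero.mpr (congrArg (Nat.cast : ℕ → ℤ) h)⟩, by
      have h := P.size_eq
      rw [← (colorEquiv k).apply_symm_apply P.top, ← (colorEquiv k).apply_symm_apply P.bottom,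
        card_colorEquiv, sum_colorEquiv, sum_colorEquiv] at h
      refine Eq.trans ?_ h
      simp only [NeutralFamily.weight, FinsetPair.weight, Finset.sum_add_distrib]
      simp
      ring⟩
  invFun x :=
    { top := colorEquiv k fun c => (x.1.1 c).1
      bottom := colorEquiv k fun c => (x.1.1 c).2
      card_eq := by
        have h := x.1.2
        simp only [charge, Finset.sum_sub_distrib, sub_eq_zero] at h
        rw [card_colorEquiv, card_colorEquiv]
        exact_mod_cast h
      size_eq := by
        rw [card_colorEquiv, sum_colorEquiv, sum_colorEquiv]
        refine Eq.trans ?_ x.2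
        simp only [NeutralFamily.weight, FinsetPair.weight, Finset.sum_add_distrib]
        simp
        ring }
  left_inv P := by ext1 <;> simp
  right_inv x := by
    ext : 2
    funext c
    simp

theorem familyEquiv_rotate {k n : ℕ} (P : ColoredFrobeniusPartition k n) (c : Fin k) :
    (familyEquiv k n P.rotate).1.1 c = (familyEquiv k n P).1.1 ((finRotate k).symm c) := by
  have h (s : Finset (ℕ × Fin k)) : (colorEquiv k).symm (s.map (shiftColor k).toEmbedding) =
      (colorEquiv k).symm s ∘ (finRotate k).symm := by
    rw [Equiv.symm_apply_eq, ← colorEquiv_map_shiftColor, Equiv.apply_symm_apply]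
  simp [familyEquiv, rotate, h]

theorem familyEquiv_iterate_rotate {k n : ℕ} (P : ColoredFrobeniusPartition k n) (m : ℕ)
    (c : Fin k) : (familyEquiv k n (rotate^[m] P)).1.1 c =
      (familyEquiv k n P).1.1 ((finRotate k).symm^[m] c) := by
  induction m generalizing c with
  | zero => rfl
  | succ m ih =>
    rw [Function.iterate_succ_apply', familyEquiv_rotate, ih, Function.iterate_succ_apply]

theorem iterate_rotate_eq_iff {k n : ℕ} (P : ColoredFrobeniusPartition k n) (m : ℕ) :
    rotate^[m] P = P ↔ ∀ c, (familyEquiv k n P).1.1 ((finRotate k).symm^[m] c) =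
      (familyEquiv k n P).1.1 c := by
  rw [← (familyEquiv k n).injective.eq_iff, Subtype.ext_iff, Subtype.ext_iff, funext_iff]
  simp_rw [familyEquiv_iterate_rotate]

/-- The period divides 4, and a proper divisor of 4 divides 2. -/
theorem minimalPeriod_rotate_eq_four_iff {n : ℕ} (P : ColoredFrobeniusPartition 4 n) :
    Function.minimalPeriod rotate P = 4 ↔ ¬ rotate^[2] P = P := by
  have h4 : Function.minimalPeriod rotate P ∣ 2 ^ (1 + 1) :=
    Function.IsPeriodicPt.minimalPeriod_dvd <| (iterate_rotate_eq_iff P 4).mpr fun c =>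
      congrArg _ (by revert c; decide)
  constructor
  · intro h h2
    have := Function.IsPeriodicPt.minimalPeriod_dvd (f := rotate) (n := 2) (x := P) h2
    rw [h] at this
    omega
  · intro h
    refine Nat.eq_prime_pow_of_dvd_least_prime_pow Nat.prime_two (fun h2 => h ?_) h4
    exact (Function.isPeriodicPt_iff_minimalPeriod_dvd (n := 2)).mpr h2

theorem iterate_rotate_two_eq_iff {n : ℕ} (P : ColoredFrobeniusPartition 4 n) :
    rotate^[2] P = P ↔ (familyEquiv 4 n P).1.1 2 = (familyEquiv 4 n P).1.1 0 ∧
      (familyEquiv 4 n P).1.1 3 = (familyEquiv 4 n P).1.1 1 := by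
  rw [iterate_rotate_eq_iff, Fin.forall_fin_succ, Fin.forall_fin_succ, Fin.forall_fin_two]
  have h0 : (finRotate 4).symm^[2] 0 = 2 := by decide
  have h1 : (finRotate 4).symm^[2] 1 = 3 := by decide
  have h2 : (finRotate 4).symm^[2] 2 = 0 := by decide
  have h3 : (finRotate 4).symm^[2] 3 = 1 := by decide
  change ((familyEquiv 4 n P).1.1 ((finRotate 4).symm^[2] 0) = _ ∧
    (familyEquiv 4 n P).1.1 ((finRotate 4).symm^[2] 1) = (familyEquiv 4 n P).1.1 1 ∧
    (familyEquiv 4 n P).1.1 ((finRotate 4).symm^[2] 2) = (familyEquiv 4 n P).1.1 2 ∧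
    (familyEquiv 4 n P).1.1 ((finRotate 4).symm^[2] 3) = (familyEquiv 4 n P).1.1 3) ↔ _
  rw [h0, h1, h2, h3]
  grind

/-- Repeating two colors gives the generalized Frobenius partitions with four colors that are
fixed under the square of the cyclic permutation of the colors. -/
def repeatColorsEquiv (n : ℕ) : {x : NeutralFamily 2 // x.weight = n} ≃
    {x : {x : NeutralFamily 4 // x.weight = 2 * n} //
      x.1.1 2 = x.1.1 0 ∧ x.1.1 3 = x.1.1 1} where
  toFun x := ⟨⟨⟨![x.1.1 0, x.1.1 1, x.1.1 0, x.1.1 1], by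
      have h := x.1.2
      simp [Fin.sum_univ_four, Fin.sum_univ_two] at h ⊢
      linarith⟩, by
      have h := x.2
      simp [NeutralFamily.weight, Fin.sum_univ_four, Fin.sum_univ_two] at h ⊢
      linarith⟩, rfl, rfl⟩
  invFun x := ⟨⟨![x.1.1.1 0, x.1.1.1 1], by
      have h := x.1.1.2
      rw [Fin.sum_univ_four, x.2.1, x.2.2] at h
      simp [Fin.sum_univ_two]
      linarith⟩, by
      have h := x.1.2
      rw [NeutralFamily.weight, Fin.sum_univ_four, x.2.1, x.2.2] at h
      simp [NeutralFamily.weight, Fin.sum_univ_two]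
      linarith⟩
  left_inv x := by
    ext : 2
    funext c
    fin_cases c <;> rfl
  right_inv x := by
    ext : 3
    funext c
    fin_cases c
    · rfl
    · rfl
    · exact x.2.1.symm
    · exact x.2.2.symm

theorem card_fixed (n : ℕ) :
    Nat.card {P : ColoredFrobeniusPartition 4 (2 * n) // rotate^[2] P = P} =
      Nat.card (ColoredFrobeniusPartition 2 n) :=
  Nat.card_congr <| ((familyEquiv 4 (2 * n)).subtypeEquiv fun P =>
    iterate_rotate_two_eq_iff P).trans <|
    (repeatColorsEquiv n).symm.trans (familyEquiv 2 n).symm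

theorem cphiBar_four_add_card (n : ℕ) :
    cphiBar 4 (2 * n) + Nat.card (ColoredFrobeniusPartition 2 n) =
      Nat.card (ColoredFrobeniusPartition 4 (2 * n)) := by
  classical
  rw [← card_fixed, cphiBar, ← Nat.card_congr (Equiv.sumCompl
    fun P : ColoredFrobeniusPartition 4 (2 * n) => rotate^[2] P = P), Nat.card_sum, add_comm]
  simp_rw [minimalPeriod_rotate_eq_four_iff]

theorem finiteFibers_weight (k : ℕ) : FiniteFibers (NeutralFamily.weight (k := k)) := fun n =>
  Finite.of_equiv _ (familyEquiv k n)

theorem natCast_card (R : Type*) [CommRing R] (k n : ℕ) :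
    (Nat.card (ColoredFrobeniusPartition k n) : R) =
      coeff n (genFun (NeutralFamily.weight (k := k)) fun _ => 1) := by
  rw [coeff_genFun_one (finiteFibers_weight k), Nat.card_congr (familyEquiv k n)]

end ColoredFrobeniusPartition

/-! ### Generating functions for two and four colors -/

namespace NeutralFamily

/-- The parametrization of neutral families with two colors by charge and neutral parts. -/
def twoEquiv : ℤ × ({x // charge x = 0} × {x // charge x = 0}) ≃ NeutralFamily 2 where
  toFun p := ⟨![chargeEquiv (p.1, p.2.1), chargeEquiv (-p.1, p.2.2)], by
    simp [Fin.sum_univ_two, charge_chargeEquiv]⟩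
  invFun x := (charge (x.1 0), (chargeEquiv.symm (x.1 0)).2, (chargeEquiv.symm (x.1 1)).2)
  left_inv p := by simp [charge_chargeEquiv]
  right_inv x := by
    have h := x.2
    rw [Fin.sum_univ_two] at h
    have h1 : -charge (x.1 0) = charge (x.1 1) := by linarith
    ext : 1
    funext c
    fin_cases c
    · exact chargeEquiv.apply_symm_apply (x.1 0)
    · simp only [h1]
      exact chargeEquiv.apply_symm_apply (x.1 1)

/-- The parametrization of neutral families with four colors by charges and neutral parts. -/
def fourEquiv : (ℤ × ℤ × ℤ) × (({x // charge x = 0} × {x // charge x = 0}) ×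
    ({x // charge x = 0} × {x // charge x = 0})) ≃ NeutralFamily 4 where
  toFun p := ⟨![chargeEquiv (p.1.1, p.2.1.1), chargeEquiv (p.1.2.1, p.2.1.2),
    chargeEquiv (p.1.2.2, p.2.2.1), chargeEquiv (-(p.1.1 + p.1.2.1 + p.1.2.2), p.2.2.2)], by
    simp [Fin.sum_univ_four, charge_chargeEquiv]⟩
  invFun x := ((charge (x.1 0), charge (x.1 1), charge (x.1 2)),
    ((chargeEquiv.symm (x.1 0)).2, (chargeEquiv.symm (x.1 1)).2),
    ((chargeEquiv.symm (x.1 2)).2, (chargeEquiv.symm (x.1 3)).2))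
  left_inv p := by simp [charge_chargeEquiv]
  right_inv x := by
    have h := x.2
    rw [Fin.sum_univ_four] at h
    have h1 : -(charge (x.1 0) + charge (x.1 1) + charge (x.1 2)) = charge (x.1 3) := by linarith
    ext : 1
    funext c
    fin_cases c
    · exact chargeEquiv.apply_symm_apply (x.1 0)
    · exact chargeEquiv.apply_symm_apply (x.1 1)
    · exact chargeEquiv.apply_symm_apply (x.1 2)
    · simp only [h1]
      exact chargeEquiv.apply_symm_apply (x.1 3)

variable (R : Type*) [CommRing R]

theorem genFun_two :
    genFun (weight (k := 2)) (fun _ => (1 : R)) = squareTheta R * neutralFun R ^ 2 := by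
  have hw := finiteFibers_weight_val
  rw [sq, squareTheta, neutralFun, ← genFun_mul_one hw hw,
    ← genFun_mul_one finiteFibers_natAbs_sq (hw.prod hw)]
  symm
  refine genFun_congr twoEquiv (fun p => ?_) fun _ => rfl
  simp only [weight, twoEquiv, Fin.sum_univ_two, Equiv.coe_fn_mk, Matrix.cons_val_zero,
    Matrix.cons_val_one, weight_chargeEquiv]
  zify
  rw [sq_abs, ← mul_right_inj' (two_ne_zero' ℤ)]
  -- The charges are `m` and `-m`, so the linear terms of the triangular numbers cancel and `m^2`
  -- remains.
  linear_combination -two_mul_triangular p.1 - two_mul_triangular (-p.1)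

theorem genFun_four :
    genFun (weight (k := 4)) (fun _ => (1 : R)) =
      genFun tetrahedralForm (fun _ => 1) * neutralFun R ^ 4 := by
  have hw := finiteFibers_weight_val
  rw [show neutralFun R ^ 4 = (neutralFun R * neutralFun R) * (neutralFun R * neutralFun R) by
    ring, neutralFun, ← genFun_mul_one hw hw, ← genFun_mul_one (hw.prod hw) (hw.prod hw),
    ← genFun_mul_one finiteFibers_tetrahedralForm ((hw.prod hw).prod (hw.prod hw))]
  symm
  refine genFun_congr fourEquiv (fun p => ?_) fun _ => rfl
  simp only [weight, fourEquiv, Fin.sum_univ_four, Equiv.coe_fn_mk, Matrix.cons_val,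
    weight_chargeEquiv]
  zify
  rw [← mul_right_inj' (two_ne_zero' ℤ)]
  linear_combination two_mul_tetrahedralForm p.1 - two_mul_triangular p.1.1 -
    two_mul_triangular p.1.2.1 - two_mul_triangular p.1.2.2 -
    two_mul_triangular (-(p.1.1 + p.1.2.1 + p.1.2.2))

end NeutralFamily

theorem theorem4 (n : ℕ) : cphiBar 4 (10 * n + 6) ≡ 0 [MOD 5] := by
  have h := congrArg (Nat.cast : ℕ → ZMod 5)
    (ColoredFrobeniusPartition.cphiBar_four_add_card (5 * n + 3))
  rw [Nat.cast_add, ColoredFrobeniusPartition.natCast_card, ColoredFrobeniusPartition.natCast_card,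
    NeutralFamily.genFun_two, NeutralFamily.genFun_four, coeff_squareTheta_mul_neutralFun,
    show 2 * (5 * n + 3) = 10 * n + 6 by ring, coeff_genFun_tetrahedralForm_mul_neutralFun,
    add_zero] at h
  rw [← ZMod.natCast_eq_natCast_iff, h, Nat.cast_zero]
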